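/- Let $R$ be an associative ring with identity, not necessarily commutative. A left $R$-module $M$ is called $n$-presented if there is an exact sequence of left $R$-modules $F_n\to F_{n-1}\to\cdots\to F_0\to M\to 0$ with every $F_i$ finitely generated and free. Let $n\ge 1$ be an integer and let $\mathscr{X}$ be a class of left $R$-modules such that the subclass $\mathscr{X}_n$ of $n$-presented modules in $\mathscr{X}$ is not empty. We say that $R$ is left $n$-$\mathscr{X}$-coherent if $\mathscr{X}_n$ is not empty and every module in $\mathscr{X}_n$ is $(n+1)$-presented; that a right $R$-module $P$ is $n$-$\mathscr{X}$-flat if $\mathrm{Tor}^R_n(P,N)=0$ for every $N\in\mathscr{X}_n$; and that a left $R$-module $M$ is $n$-$\mathscr{X}$-injective if $\mathrm{Ext}_R^n(N,M)=0$ for every $N\in\mathscr{X}_n$. Then the following assertions are equivalent: 1. $R$ is left $n$-$\mathscr{X}$-coherent. 2. For every set $J$, the right $R$-module $R^J$ is $n$-$\mathscr{X}$-flat. 3. For every family $(P_j)_{j\in J}$ of $n$-$\mathscr{X}$-flat right $R$-modules, the direct product $\prod_{j\in J}P_j$ is $n$-$\mathscr{X}$-flat. 4. For every direct system $(N_j)_{j\in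 J}$ of $n$-$\mathscr{X}$-injective left $R$-modules over a (nonempty) directed index set $J$, the direct limit $\varinjlim N_j$ is $n$-$\mathscr{X}$-injective. -/

import Mathlib

open CategoryTheory
open scoped TensorProduct

universe u

/-! Right modules over `R` are modules over the opposite ring `Rᵐᵒᵖ`; left modules are modules
over `R`. The ring `R` is not assumed commutative. -/

namespace NXCoh

noncomputable section

section Tensor

variable {R : Type u} [Ring R]

variable (R) in
/-- The subgroup of `P ⊗[ℤ] M` generated by the elements `(p r) ⊗ m - p ⊗ (r m)`, where `P` is
a right and `M` a left `R`-module. -/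
def balancing (P : Type u) [AddCommGroup P] [Module Rᵐᵒᵖ P]
    (M : Type u) [AddCommGroup M] [Module R M] : AddSubgroup (P ⊗[ℤ] M) :=
  AddSubgroup.closure {x | ∃ (p : P) (r : R) (m : M),
    x = (MulOpposite.op r • p) ⊗ₜ[ℤ] m - p ⊗ₜ[ℤ] (r • m)}

variable (R) in
/-- The tensor product `P ⊗_R M` of a right `R`-module `P` and a left `R`-module `M`,
an abelian group. -/
abbrev Tensor (P : Type u) [AddCommGroup P] [Module Rᵐᵒᵖ P]
    (M : Type u) [AddCommGroup M] [Module R M] : Type u :=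
  (P ⊗[ℤ] M) ⧸ balancing R P M

variable (P : Type u) [AddCommGroup P] [Module Rᵐᵒᵖ P]
  {M : Type u} [AddCommGroup M] [Module R M] {N : Type u} [AddCommGroup N] [Module R N]
  {L : Type u} [AddCommGroup L] [Module R L]

/-- The homomorphism `P ⊗_R f : P ⊗_R M → P ⊗_R N` induced by an `R`-linear map `f : M → N`. -/
def tensorMap (f : M →ₗ[R] N) : Tensor R P M →+ Tensor R P N :=
  QuotientAddGroup.map (balancing R P M) (balancing R P N)
    (LinearMap.lTensor P (f.restrictScalars ℤ)).toAddMonoidHom (by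
      rw [balancing, AddSubgroup.closure_le]
      rintro _ ⟨p, r, m, rfl⟩
      exact AddSubgroup.subset_closure ⟨p, r, f m, by simp⟩)

theorem tensorMap_mk_tmul (f : M →ₗ[R] N) (p : P) (m : M) :
    tensorMap P f (QuotientAddGroup.mk (p ⊗ₜ[ℤ] m)) = QuotientAddGroup.mk (p ⊗ₜ[ℤ] f m) :=
  rfl

theorem tensor_hom_ext {A : Type u} [AddCommGroup A] {f g : Tensor R P M →+ A}
    (h : ∀ (p : P) (m : M), f (QuotientAddGroup.mk (p ⊗ₜ[ℤ] m)) =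
      g (QuotientAddGroup.mk (p ⊗ₜ[ℤ] m))) : f = g := by
  refine QuotientAddGroup.addMonoidHom_ext _ (AddMonoidHom.ext fun x => ?_)
  induction x using TensorProduct.induction_on with
  | zero => simp only [map_zero]
  | tmul p m => exact h p m
  | add a b ha hb => rw [map_add, map_add, ha, hb]

theorem tensorMap_id : tensorMap P (LinearMap.id : M →ₗ[R] M) = AddMonoidHom.id _ :=
  tensor_hom_ext P fun _ _ => rfl

theorem tensorMap_comp (g : N →ₗ[R] L) (f : M →ₗ[R] N) :
    tensorMap P (g ∘ₗ f) = (tensorMap P g).comp (tensorMap P f) :=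
  tensor_hom_ext P fun _ _ => rfl

theorem tensorMap_add (f g : M →ₗ[R] N) :
    tensorMap P (f + g) = tensorMap P f + tensorMap P g :=
  tensor_hom_ext P fun p m => by
    rw [AddMonoidHom.add_apply, tensorMap_mk_tmul, tensorMap_mk_tmul, tensorMap_mk_tmul,
      LinearMap.add_apply, TensorProduct.tmul_add, QuotientAddGroup.mk_add]

/-- The functor `P ⊗_R -` from left `R`-modules to abelian groups, for a right `R`-module `P`. -/
def tensorFunctor (P : ModuleCat.{u} Rᵐᵒᵖ) : ModuleCat.{u} R ⥤ AddCommGrpCat.{u} where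
  obj M := AddCommGrpCat.of (Tensor R P M)
  map f := AddCommGrpCat.ofHom (tensorMap P f.hom)
  map_id M := AddCommGrpCat.hom_ext (tensorMap_id (M := M) P)
  map_comp f g := AddCommGrpCat.hom_ext (tensorMap_comp P g.hom f.hom)

instance (P : ModuleCat.{u} Rᵐᵒᵖ) : (tensorFunctor (R := R) P).Additive where
  map_add {_ _ f g} := AddCommGrpCat.hom_ext (tensorMap_add P f.hom g.hom)

/-- `Tor_n^R(P, M)` for a right `R`-module `P` and a left `R`-module `M`: the value at `M` of the
`n`-th left derived functor of `P ⊗_R -`. -/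
def Tor (n : ℕ) (P : ModuleCat.{u} Rᵐᵒᵖ) (M : ModuleCat.{u} R) : AddCommGrpCat.{u} :=
  ((tensorFunctor P).leftDerived n).obj M

end Tensor

variable {R : Type u} [Ring R]

/-- `M` is `n`-presented: there is an exact sequence `F n → ⋯ → F 1 → F 0 → M → 0` of `R`-modules
with each `F i` finitely generated and free. (Only `F 0, …, F n` and the maps `d i` with `i < n`
are constrained.) -/
def IsNPresented (n : ℕ) (M : ModuleCat.{u} R) : Prop :=
  ∃ (F : ℕ → ModuleCat.{u} R) (d : ∀ i, F (i + 1) →ₗ[R] F i) (ε : F 0 →ₗ[R] M),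
    (∀ i ≤ n, Module.Finite R (F i) ∧ Module.Free R (F i)) ∧
    Function.Surjective ε ∧
    (1 ≤ n → Function.Exact (d 0) ε) ∧
    (∀ i, i + 2 ≤ n → Function.Exact (d (i + 1)) (d i))

/-- The subclass of `n`-presented modules of a class `X` of left `R`-modules. -/
def nPresentedSubclass (X : ObjectProperty (ModuleCat.{u} R)) (n : ℕ) :
    ObjectProperty (ModuleCat.{u} R) :=
  fun M => X M ∧ IsNPresented n M

/-- `R` is left `n`-`X`-coherent: the subclass of `n`-presented modules of `X` is not empty and
each of its members is `(n+1)`-presented. -/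
def IsLeftCoherent (X : ObjectProperty (ModuleCat.{u} R)) (n : ℕ) : Prop :=
  (∃ M, nPresentedSubclass X n M) ∧ ∀ M, nPresentedSubclass X n M → IsNPresented (n + 1) M

/-- A right `R`-module `P` is `n`-`X`-flat: `Tor_n^R(P, N) = 0` for every `n`-presented `N`
in `X`. -/
def IsFlat (X : ObjectProperty (ModuleCat.{u} R)) (n : ℕ) (P : ModuleCat.{u} Rᵐᵒᵖ) : Prop :=
  ∀ N, nPresentedSubclass X n N → Subsingleton (Tor n P N)

/-- A left `R`-module `M` is `n`-`X`-injective: `Ext^n_R(N, M) = 0` for every `n`-presented `N`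
in `X`. -/
def IsInjective (X : ObjectProperty (ModuleCat.{u} R)) (n : ℕ) (M : ModuleCat.{u} R) : Prop :=
  ∀ N, nPresentedSubclass X n N → Subsingleton (Abelian.Ext N M n)

end

end NXCoh

/-! Put `n = m + 1` and resolve `N` by free modules `F i`, finitely generated for `i ≤ n`. Let `K`
be the image of `F (n+1)` in `F n`. If `K` is finitely generated, then `N` is `(n+1)`-presented.
`Tor_n(P, N) = 0` says that `P ⊗ F (n+1) → P ⊗ F n → P ⊗ F (n-1)` is exact. `Ext^n(N, M) = 0` says
that every map `F n → M` killing `K` factors through `F n → F (n-1)`.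

Under coherence, `F (n+1)` can be chosen finitely generated too. Tensoring with finitely generated
free modules commutes with products, and maps out of them commute with direct limits, so flatness
passes to products and injectivity to direct limits.

Conversely, take `R^K`: the tautological family of elements of `K` lifts to `R^K ⊗ F (n+1)`, and a
lift is a finite sum of tensors, so it involves only finitely many generators of `K`
(`fg_range_of_exact_tensorMap_pi`). For direct limits, `K` is the directed union of its finitely
generated submodules `S`; a direct limit of products of injectives containing the quotients `F n /
S` forces `K` to equal some `S` (`fg_of_exists_extension`). -/

namespace NXCoh

variable {R : Type u} [Ring R]

/-! ### Vanishing of Tor and Ext in positive degree, read off a free resolution. -/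

/-- A free resolution of `N`, given by modules, differentials and an augmentation. -/
structure FreeResolution (N : ModuleCat.{u} R) where
  /-- The modules of the resolution. -/
  F : ℕ → ModuleCat.{u} R
  /-- The differentials. -/
  d : ∀ i, F (i + 1) →ₗ[R] F i
  /-- The augmentation. -/
  ε : F 0 →ₗ[R] N
  free : ∀ i, Module.Free R (F i)
  surjective : Function.Surjective ε
  exact_zero : Function.Exact (d 0) ε
  exact_succ : ∀ i, Function.Exact (d (i + 1)) (d i)

namespace FreeResolution

section Projective

variable {N : ModuleCat.{u} R} (Q : FreeResolution N)

/-- The chain complex of a free resolution. -/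
noncomputable def complex : ChainComplex (ModuleCat.{u} R) ℕ :=
  ChainComplex.of Q.F (fun i => ModuleCat.ofHom (Q.d i)) fun i => by
    ext x
    exact (Q.exact_succ i).apply_apply_eq_zero x

theorem complex_d (i : ℕ) : Q.complex.d (i + 1) i = ModuleCat.ofHom (Q.d i) :=
  ChainComplex.of_d (X := Q.F) (d := fun i => ModuleCat.ofHom (Q.d i)) i

theorem complex_d_comp_augmentation :
    Q.complex.d 1 0 ≫ (ModuleCat.ofHom Q.ε : Q.complex.X 0 ⟶ N) = 0 := by
  rw [complex_d]
  ext x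
  exact Q.exact_zero.apply_apply_eq_zero x

/-- The augmentation as a morphism of complexes. -/
noncomputable def π : Q.complex ⟶ (ChainComplex.single₀ _).obj N :=
  (ChainComplex.toSingle₀Equiv _ _).symm ⟨_, Q.complex_d_comp_augmentation⟩

theorem π_f_zero : Q.π.f 0 = ModuleCat.ofHom Q.ε :=
  ChainComplex.toSingle₀Equiv_symm_apply_f_zero _ Q.complex_d_comp_augmentation

theorem exactAt_succ (i : ℕ) : Q.complex.ExactAt (i + 1) := by
  rw [HomologicalComplex.exactAt_iff' _ (i + 2) (i + 1) i (by simp) (by simp),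
    ShortComplex.moduleCat_exact_iff]
  intro x hx
  change (Q.complex.d (i + 1) i).hom x = 0 at hx
  change ∃ y, (Q.complex.d (i + 2) (i + 1)).hom y = x
  rw [complex_d] at hx ⊢
  exact (Q.exact_succ i x).1 hx

theorem exact_and_epi_augmentation :
    (ShortComplex.mk _ _ Q.complex_d_comp_augmentation).Exact ∧
      Epi (ShortComplex.mk _ _ Q.complex_d_comp_augmentation).g := by
  refine ⟨(ShortComplex.moduleCat_exact_iff _).2 fun x hx => ?_,
    (ModuleCat.epi_iff_surjective _).2 Q.surjective⟩
  change ∃ y, (Q.complex.d 1 0).hom y = x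
  rw [complex_d]
  exact (Q.exact_zero x).1 hx

instance quasiIso_π : QuasiIso Q.π where
  quasiIsoAt i := by
    cases i with
    | zero =>
      rw [ChainComplex.quasiIsoAt₀_iff, ShortComplex.quasiIso_iff_of_zeros']
      · refine (ShortComplex.exact_and_epi_g_iff_of_iso ?_).2 Q.exact_and_epi_augmentation
        exact ShortComplex.isoMk (Iso.refl _) (Iso.refl _) (Iso.refl _)
          ((Category.id_comp _).trans (Category.comp_id _).symm)
          ((Category.id_comp _).trans (Q.π_f_zero.symm.trans (Category.comp_id _).symm))
      all_goals rfl
    | succ i =>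
      rw [quasiIsoAt_iff_exactAt' _ _ (ChainComplex.exactAt_succ_single_obj _ _)]
      exact Q.exactAt_succ i

/-- A free resolution as a projective resolution. -/
noncomputable def toProjectiveResolution : ProjectiveResolution N where
  complex := Q.complex
  projective i := by
    have := Q.free i
    have := Module.Projective.of_free (R := R) (P := Q.F i)
    exact (IsProjective.iff_projective (R := R) (P := Q.F i)).1 this
  π := Q.π

/-- Degree `m + 1` classes are cocycles `φ` on `Q.F (m + 1)` modulo maps that factor through `Q.d
m`. -/
theorem subsingleton_ext_iff (M : ModuleCat.{u} R) (m : ℕ) :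
    Subsingleton (Abelian.Ext N M (m + 1)) ↔
      ∀ φ : Q.F (m + 1) →ₗ[R] M, φ ∘ₗ Q.d (m + 1) = 0 →
        ∃ ψ : Q.F m →ₗ[R] M, ψ ∘ₗ Q.d m = φ := by
  set P := Q.toProjectiveResolution
  have hd (i : ℕ) : P.complex.d (i + 1) i = ModuleCat.ofHom (Q.d i) := Q.complex_d i
  constructor
  · intro h φ hφ
    have hφ' : P.complex.d (m + 2) (m + 1) ≫ (ModuleCat.ofHom φ : P.complex.X (m + 1) ⟶ M) = 0 := by
      rw [hd]
      exact ModuleCat.hom_ext hφ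
    obtain ⟨g, hg⟩ := (P.extMk_eq_zero_iff _ _ rfl hφ' m rfl).1 (Subsingleton.elim _ _)
    rw [hd] at hg
    exact ⟨g.hom, congrArg ModuleCat.Hom.hom hg⟩
  · intro h
    refine subsingleton_of_forall_eq 0 fun α => ?_
    obtain ⟨f, hf, rfl⟩ := P.extMk_surjective α (m + 2) rfl
    refine (P.extMk_eq_zero_iff _ _ rfl hf m rfl).2 ?_
    rw [hd] at hf ⊢
    obtain ⟨ψ, hψ⟩ := h f.hom (congrArg ModuleCat.Hom.hom hf)
    exact ⟨ModuleCat.ofHom ψ, ModuleCat.hom_ext hψ⟩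

theorem subsingleton_tor_iff (P : ModuleCat.{u} Rᵐᵒᵖ) (m : ℕ) :
    Subsingleton (Tor (m + 1) P N) ↔
      Function.Exact (tensorMap P (Q.d (m + 1))) (tensorMap P (Q.d m)) := by
  let K := ((tensorFunctor P).mapHomologicalComplex _).obj Q.complex
  have hd (i : ℕ) : K.d (i + 1) i = AddCommGrpCat.ofHom (tensorMap P (Q.d i)) := by
    change (tensorFunctor P).map (Q.complex.d (i + 1) i) = _
    rw [complex_d]
    rfl
  have hK : Subsingleton (Tor (m + 1) P N) ↔ K.ExactAt (m + 1) := by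
    rw [HomologicalComplex.exactAt_iff_isZero_homology, ← AddCommGrpCat.isZero_iff_subsingleton]
    exact (Q.toProjectiveResolution.isoLeftDerivedObj (tensorFunctor P) (m + 1)).isZero_iff
  rw [hK, HomologicalComplex.exactAt_iff' _ (m + 2) (m + 1) m (by simp) (by simp),
    ShortComplex.ab_exact_iff_function_exact]
  change Function.Exact (K.d (m + 2) (m + 1)).hom (K.d (m + 1) m).hom ↔ _
  rw [hd, hd]
  rfl

end Projective
end FreeResolution
-- Construction of free resolutions.
namespace FreeResolution

/-- The modules of a free resolution extended by one term. -/
def consF (A : ModuleCat.{u} R) (F : ℕ → ModuleCat.{u} R) : ℕ → ModuleCat.{u} R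
  | 0 => A
  | i + 1 => F i

/-- The differentials of a free resolution extended by one term. -/
def consD {A : ModuleCat.{u} R} {F : ℕ → ModuleCat.{u} R} (d : ∀ i, F (i + 1) →ₗ[R] F i)
    (d₀ : F 0 →ₗ[R] A) : ∀ i, consF A F (i + 1) →ₗ[R] consF A F i
  | 0 => d₀
  | i + 1 => d i

/-- Splicing a free resolution of the kernel of a surjection from a free module. -/
def cons {N A : ModuleCat.{u} R} (hA : Module.Free R A) (e : A →ₗ[R] N)
    (he : Function.Surjective e) (Q : FreeResolution (ModuleCat.of R (LinearMap.ker e))) :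
    FreeResolution N where
  F := consF A Q.F
  d := consD Q.d ((LinearMap.ker e).subtype ∘ₗ Q.ε)
  ε := e
  free
    | 0 => hA
    | i + 1 => Q.free i
  surjective := he
  exact_zero x := by
    constructor
    · intro hx
      obtain ⟨y, hy⟩ := Q.surjective ⟨x, hx⟩
      exact ⟨y, congrArg Subtype.val hy⟩
    · rintro ⟨y, rfl⟩
      exact (Q.ε y).2
  exact_succ
    | 0 => fun x => by
      refine Iff.trans ?_ (Q.exact_zero x)
      exact Submodule.coe_eq_zero
    | i + 1 => Q.exact_succ i

section Tail

variable {N : ModuleCat.{u} R} (Q : FreeResolution N)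

/-- The free resolution of the first syzygy obtained by dropping the first term. -/
def tail : FreeResolution (ModuleCat.of R (LinearMap.ker Q.ε)) where
  F i := Q.F (i + 1)
  d i := Q.d (i + 1)
  ε := (Q.d 0).codRestrict _ fun x => Q.exact_zero.apply_apply_eq_zero x
  free i := Q.free (i + 1)
  surjective := by
    rintro ⟨x, hx⟩
    obtain ⟨y, hy⟩ := (Q.exact_zero x).1 hx
    exact ⟨y, Subtype.ext hy⟩
  exact_zero x := by
    refine Iff.trans ?_ (Q.exact_succ 0 x)
    exact Subtype.ext_iff
  exact_succ i := Q.exact_succ (i + 1)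

end Tail

/-- The kernel of the canonical map to `M` from the free module on its elements. -/
noncomputable def canonicalSyzygy (M : ModuleCat.{u} R) : ModuleCat.{u} R :=
  ModuleCat.of R (LinearMap.ker (Finsupp.linearCombination R (id : M → M)))

/-- The canonical syzygies of `N`. -/
noncomputable def iteratedSyzygy (N : ModuleCat.{u} R) : ℕ → ModuleCat.{u} R
  | 0 => N
  | i + 1 => canonicalSyzygy (iteratedSyzygy N i)

/-- The canonical free resolution of a module. -/
noncomputable def canonical (N : ModuleCat.{u} R) : FreeResolution N where
  F i := ModuleCat.of R (iteratedSyzygy N i →₀ R)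
  d i := (LinearMap.ker (Finsupp.linearCombination R
    (id : iteratedSyzygy N i → iteratedSyzygy N i))).subtype ∘ₗ
      Finsupp.linearCombination R (id : iteratedSyzygy N (i + 1) → iteratedSyzygy N (i + 1))
  ε := Finsupp.linearCombination R (id : N → N)
  free i := inferInstanceAs (Module.Free R (iteratedSyzygy N i →₀ R))
  surjective := Finsupp.linearCombination_id_surjective R N
  exact_zero x := by
    constructor
    · intro hx
      obtain ⟨y, hy⟩ := Finsupp.linearCombination_id_surjective R (iteratedSyzygy N 1) ⟨x, hx⟩
      exact ⟨y, congrArg Subtype.val hy⟩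
    · rintro ⟨y, rfl⟩
      exact (Finsupp.linearCombination R (id : iteratedSyzygy N 1 → iteratedSyzygy N 1) y).2
  exact_succ i x := by
    constructor
    · intro hx
      obtain ⟨y, hy⟩ := Finsupp.linearCombination_id_surjective R (iteratedSyzygy N (i + 2))
        ⟨x, Submodule.coe_eq_zero.1 hx⟩
      exact ⟨y, congrArg Subtype.val hy⟩
    · rintro ⟨y, rfl⟩
      exact Submodule.coe_eq_zero.2
        (Finsupp.linearCombination R (id : iteratedSyzygy N (i + 2) → iteratedSyzygy N (i + 2)) y).2

end FreeResolution

/-! ### Finite presentations and syzygies. -/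

theorem exists_finite_free_surjective (M : Type u) [AddCommGroup M] [Module R M]
    [Module.Finite R M] : ∃ (A : ModuleCat.{u} R) (e : A →ₗ[R] M),
      Module.Finite R A ∧ Module.Free R A ∧ Function.Surjective e := by
  obtain ⟨s, hs⟩ := Module.Finite.fg_top (R := R) (M := M)
  refine ⟨ModuleCat.of R (s →₀ R), Finsupp.linearCombination R Subtype.val,
    inferInstanceAs (Module.Finite R (s →₀ R)), inferInstanceAs (Module.Free R (s →₀ R)), ?_⟩
  rw [← LinearMap.range_eq_top]
  exact (Finsupp.range_linearCombination R).trans (by simpa using hs)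

theorem isNPresented_zero_iff {N : ModuleCat.{u} R} : IsNPresented 0 N ↔ Module.Finite R N := by
  constructor
  · rintro ⟨F, d, ε, hF, hε, -, -⟩
    have := (hF 0 le_rfl).1
    exact Module.Finite.of_surjective ε hε
  · intro h
    obtain ⟨A, e, hA, hA', he⟩ := exists_finite_free_surjective (R := R) N
    exact ⟨fun _ => A, fun _ => 0, e, fun _ _ => ⟨hA, hA'⟩, he, by lia, by lia⟩

/-- Cutting off `F 0`, with `of_ker` as the reverse splice. One suitable `e` is enough below, so
Schanuel's lemma is not needed. -/
theorem IsNPresented.exists_ker {n : ℕ} {N : ModuleCat.{u} R} (h : IsNPresented (n + 1) N) :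
    ∃ (A : ModuleCat.{u} R) (e : A →ₗ[R] N), Module.Finite R A ∧ Module.Free R A ∧
      Function.Surjective e ∧ IsNPresented n (ModuleCat.of R (LinearMap.ker e)) := by
  obtain ⟨F, d, ε, hF, hε, h0, h1⟩ := h
  have h0 := h0 (by lia)
  refine ⟨F 0, ε, (hF 0 (by lia)).1, (hF 0 (by lia)).2, hε, fun i => F (i + 1),
    fun i => d (i + 1), (d 0).codRestrict _ fun x => h0.apply_apply_eq_zero x,
    fun i hi => hF (i + 1) (by lia), ?_, fun hn x => ?_, fun i hi => h1 (i + 1) (by lia)⟩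
  · rintro ⟨x, hx⟩
    obtain ⟨y, hy⟩ := (h0 x).1 hx
    exact ⟨y, Subtype.ext hy⟩
  · refine Iff.trans ?_ (h1 0 (by lia) x)
    exact Subtype.ext_iff

theorem IsNPresented.of_ker {n : ℕ} {N A : ModuleCat.{u} R} (hA : Module.Finite R A)
    (hA' : Module.Free R A) (e : A →ₗ[R] N) (he : Function.Surjective e)
    (h : IsNPresented n (ModuleCat.of R (LinearMap.ker e))) : IsNPresented (n + 1) N := by
  obtain ⟨F, d, ε, hF, hε, h0, h1⟩ := h
  refine ⟨FreeResolution.consF A F,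
    FreeResolution.consD d ((LinearMap.ker e).subtype ∘ₗ ε), e, ?_, he, fun _ x => ?_, ?_⟩
  · rintro (_ | i) hi
    · exact ⟨hA, hA'⟩
    · exact hF i (by lia)
  · constructor
    · intro hx
      obtain ⟨y, hy⟩ := hε ⟨x, hx⟩
      exact ⟨y, congrArg Subtype.val hy⟩
    · rintro ⟨y, rfl⟩
      exact (ε y).2
  · rintro (_ | i) hi
    · intro x
      refine Iff.trans ?_ (h0 (by lia) x)
      exact Submodule.coe_eq_zero
    · exact h1 i (by lia)

/-- An `n`-presentation stops at `F n`, whereas Tor and Ext in degree `n` also involve `F (n + 1)`.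
-/
theorem IsNPresented.exists_freeResolution {n : ℕ} {N : ModuleCat.{u} R}
    (h : IsNPresented n N) : ∃ Q : FreeResolution N, ∀ i ≤ n, Module.Finite R (Q.F i) := by
  induction n generalizing N with
  | zero =>
    have := isNPresented_zero_iff.1 h
    obtain ⟨A, e, hA, hA', he⟩ := exists_finite_free_surjective (R := R) N
    -- Above the finitely generated part, any free resolution of the kernel will do.
    refine ⟨.cons hA' e he (.canonical _), fun i hi => ?_⟩
    obtain rfl : i = 0 := by lia
    exact hA
  | succ n ih =>
    obtain ⟨A, e, hA, hA', he, hK⟩ := h.exists_ker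
    obtain ⟨Q, hQ⟩ := ih hK
    refine ⟨.cons hA' e he Q, ?_⟩
    rintro (_ | i) hi
    · exact hA
    · exact hQ i (by lia)

theorem FreeResolution.isNPresented_succ {n : ℕ} {N : ModuleCat.{u} R} (Q : FreeResolution N)
    (hQ : ∀ i ≤ n, Module.Finite R (Q.F i)) (h : (LinearMap.range (Q.d n)).FG) :
    IsNPresented (n + 1) N := by
  -- What remains concerns `ker Q.ε`, which `Q.tail` resolves; this form is suited to induction.
  refine .of_ker (hQ 0 (by lia)) (Q.free 0) Q.ε Q.surjective ?_
  induction n generalizing N with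
  | zero =>
    rw [isNPresented_zero_iff]
    rw [← LinearMap.exact_iff.1 Q.exact_zero] at h
    exact Module.Finite.iff_fg.2 h
  | succ n ih =>
    exact .of_ker (hQ 1 (by lia)) (Q.free 1) Q.tail.ε Q.tail.surjective
      (ih Q.tail (fun i hi => hQ (i + 1) (by lia)) h)

/-! ### Tensor products with finitely generated free modules. -/

section TensorFiniteFree

variable {P : Type u} [AddCommGroup P] [Module Rᵐᵒᵖ P] {P' : Type u} [AddCommGroup P']
  [Module Rᵐᵒᵖ P'] {M : Type u} [AddCommGroup M] [Module R M] {N : Type u} [AddCommGroup N]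
  [Module R N]

/-- The homomorphism on `P ⊗_R M` induced by a balanced biadditive map. -/
def tensorLift {A : Type u} [AddCommGroup A] (β : P →+ M →+ A)
    (hβ : ∀ p (r : R) m, β (MulOpposite.op r • p) m = β p (r • m)) : Tensor R P M →+ A :=
  QuotientAddGroup.lift (balancing R P M)
    (TensorProduct.liftAddHom β fun n p m => by simp) (by
      rw [balancing, AddSubgroup.closure_le]
      rintro _ ⟨p, r, m, rfl⟩
      simp [hβ])

theorem tensorLift_mk_tmul {A : Type u} [AddCommGroup A] (β : P →+ M →+ A)
    (hβ : ∀ p (r : R) m, β (MulOpposite.op r • p) m = β p (r • m)) (p : P) (m : M) :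
    tensorLift β hβ (QuotientAddGroup.mk (p ⊗ₜ[ℤ] m)) = β p m :=
  rfl

theorem mk_smul_tmul (p : P) (r : R) (m : M) :
    (QuotientAddGroup.mk ((MulOpposite.op r • p) ⊗ₜ[ℤ] m) : Tensor R P M) =
      QuotientAddGroup.mk (p ⊗ₜ[ℤ] (r • m)) := by
  rw [← sub_eq_zero, ← QuotientAddGroup.mk_sub, QuotientAddGroup.eq_zero_iff]
  exact AddSubgroup.subset_closure ⟨p, r, m, rfl⟩

theorem tensor_induction {C : Tensor R P M → Prop} (zero : C 0)
    (tmul : ∀ (p : P) (m : M), C (QuotientAddGroup.mk (p ⊗ₜ[ℤ] m)))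
    (add : ∀ x y, C x → C y → C (x + y)) (t : Tensor R P M) : C t := by
  obtain ⟨x, rfl⟩ := QuotientAddGroup.mk_surjective t
  induction x using TensorProduct.induction_on with
  | zero => exact zero
  | tmul p m => exact tmul p m
  | add x y hx hy => exact add _ _ hx hy

variable (M) in
/-- The homomorphism `g ⊗_R M` induced by a homomorphism `g` of right `R`-modules. -/
def tensorMapLeft (g : P →ₗ[Rᵐᵒᵖ] P') : Tensor R P M →+ Tensor R P' M :=
  tensorLift (M := M)
    { toFun := fun p => AddMonoidHom.mk' (fun m => QuotientAddGroup.mk (g p ⊗ₜ[ℤ] m))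
        fun m m' => by rw [TensorProduct.tmul_add, QuotientAddGroup.mk_add]
      map_zero' := by ext; simp
      map_add' := fun p p' => by
        ext m
        simp [TensorProduct.add_tmul] }
    fun p r m => by simp [mk_smul_tmul]

theorem tensorMapLeft_mk_tmul (g : P →ₗ[Rᵐᵒᵖ] P') (p : P) (m : M) :
    tensorMapLeft M g (QuotientAddGroup.mk (p ⊗ₜ[ℤ] m)) = QuotientAddGroup.mk (g p ⊗ₜ[ℤ] m) :=
  rfl

theorem tensorMap_tensorMapLeft (g : P →ₗ[Rᵐᵒᵖ] P') (f : M →ₗ[R] N) (t : Tensor R P M) :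
    tensorMap P' f (tensorMapLeft M g t) = tensorMapLeft N g (tensorMap P f t) :=
  DFunLike.congr_fun (tensor_hom_ext (f := (tensorMap P' f).comp (tensorMapLeft M g))
    (g := (tensorMapLeft N g).comp (tensorMap P f)) P fun _ _ => rfl) t

section Basis

variable {ι : Type u} (b : Module.Basis ι R M)

/-- Coordinates on `P ⊗_R M` given by a basis of `M`. -/
noncomputable def tensorCoord : Tensor R P M →+ (ι → P) :=
  tensorLift (M := M)
    { toFun := fun p => AddMonoidHom.mk' (fun m i => MulOpposite.op (b.repr m i) • p)
        fun m m' => by ext; simp [add_smul]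
      map_zero' := by ext; simp
      map_add' := fun p p' => by ext; simp }
    fun p r m => by ext; simp [mul_smul]

theorem tensorCoord_mk_tmul (p : P) (m : M) (i : ι) :
    tensorCoord b (QuotientAddGroup.mk (p ⊗ₜ[ℤ] m)) i = MulOpposite.op (b.repr m i) • p :=
  rfl

theorem tensorCoord_tensorMapLeft (g : P →ₗ[Rᵐᵒᵖ] P') (t : Tensor R P M) (i : ι) :
    tensorCoord b (tensorMapLeft M g t) i = g (tensorCoord b t i) := by
  induction t using tensor_induction with
  | zero => simp
  | tmul p m => simp [tensorMapLeft_mk_tmul, tensorCoord_mk_tmul]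
  | add x y hx hy => simp [hx, hy]

variable [Fintype ι]

theorem sum_tensorCoord (t : Tensor R P M) :
    ∑ i, (QuotientAddGroup.mk (tensorCoord b t i ⊗ₜ[ℤ] b i) : Tensor R P M) = t := by
  induction t using tensor_induction with
  | zero => simp
  | tmul p m =>
    conv_rhs => rw [← b.sum_repr m, TensorProduct.tmul_sum, QuotientAddGroup.mk_sum]
    exact Finset.sum_congr rfl fun i _ => by rw [tensorCoord_mk_tmul, mk_smul_tmul]
  | add x y hx hy =>
    conv_rhs => rw [← hx, ← hy]
    simp [TensorProduct.add_tmul, Finset.sum_add_distrib]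

theorem tensorCoord_injective : Function.Injective (tensorCoord b (P := P)) := fun s t h => by
  rw [← sum_tensorCoord b s, h, sum_tensorCoord]

theorem tensorCoord_surjective : Function.Surjective (tensorCoord b (P := P)) := fun c => by
  classical
  refine ⟨∑ i, QuotientAddGroup.mk (c i ⊗ₜ[ℤ] b i), ?_⟩
  ext j
  simp [tensorCoord_mk_tmul, Finsupp.single_apply, apply_ite MulOpposite.op, ite_smul]

end Basis

section Pi

variable {J : Type u} (P : J → Type u) [∀ j, AddCommGroup (P j)] [∀ j, Module Rᵐᵒᵖ (P j)]
  [Module.Finite R M] [Module.Free R M]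

/-- In coordinates for a finite basis, both sides are families of elements of the `P j`. With
`exists_tensor_pi`, this makes `(∏ P j) ⊗ M → ∏ (P j ⊗ M)` bijective. -/
theorem tensor_pi_ext {s t : Tensor R (∀ j, P j) M}
    (h : ∀ j, tensorMapLeft M (LinearMap.proj j) s = tensorMapLeft M (LinearMap.proj j) t) :
    s = t := by
  refine tensorCoord_injective (Module.Free.chooseBasis R M) ?_
  ext i j
  have := congrFun (congrArg (tensorCoord (Module.Free.chooseBasis R M)) (h j)) i
  simpa only [tensorCoord_tensorMapLeft, LinearMap.proj_apply] using this

theorem exists_tensor_pi (s : ∀ j, Tensor R (P j) M) :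
    ∃ t : Tensor R (∀ j, P j) M, ∀ j, tensorMapLeft M (LinearMap.proj j) t = s j := by
  let b := Module.Free.chooseBasis R M
  obtain ⟨t, ht⟩ := tensorCoord_surjective b (P := ∀ j, P j) fun i j => tensorCoord b (s j) i
  refine ⟨t, fun j => tensorCoord_injective b ?_⟩
  ext i
  rw [tensorCoord_tensorMapLeft, ht, LinearMap.proj_apply]

/-- Componentwise preimages are assembled over `A` and compared over `B`; `C` may be arbitrary,
since an element that vanishes there has vanishing components. -/
theorem exact_tensorMap_pi {A B C : Type u} [AddCommGroup A] [AddCommGroup B] [AddCommGroup C]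
    [Module R A] [Module R B] [Module R C] [Module.Finite R A] [Module.Free R A]
    [Module.Finite R B] [Module.Free R B] {f : A →ₗ[R] B} {g : B →ₗ[R] C} (hgf : g ∘ₗ f = 0)
    (h : ∀ j, Function.Exact (tensorMap (P j) f) (tensorMap (P j) g)) :
    Function.Exact (tensorMap (∀ j, P j) f) (tensorMap (∀ j, P j) g) := by
  intro t
  constructor
  · intro ht
    choose s hs using fun j => (h j (tensorMapLeft B (LinearMap.proj j) t)).1 (by
      rw [tensorMap_tensorMapLeft, ht, map_zero])
    obtain ⟨s', hs'⟩ := exists_tensor_pi P s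
    exact ⟨s', tensor_pi_ext P fun j => by rw [← tensorMap_tensorMapLeft, hs', hs]⟩
  · rintro ⟨s, rfl⟩
    rw [← AddMonoidHom.comp_apply, ← tensorMap_comp, hgf]
    induction s using tensor_induction with
    | zero => simp
    | tmul p m => simp [tensorMap_mk_tmul]
    | add x y hx hy => rw [map_add, hx, hy, add_zero]

end Pi

section Regular

variable (R M) in
/-- The isomorphism `R ⊗_R M ≃ M`. -/
def tensorLid : Tensor R R M ≃+ M :=
  AddMonoidHom.toAddEquiv
    (tensorLift (R := R) (P := R) (M := M)
      { toFun := fun r => AddMonoidHom.mk' (fun m => r • m) (smul_add r)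
        map_zero' := by ext; simp
        map_add' := fun r s => by ext; simp [add_smul] }
      fun r s m => by simp [mul_smul])
    (AddMonoidHom.mk' (fun m => QuotientAddGroup.mk (1 ⊗ₜ[ℤ] m)) fun m m' => by
      rw [TensorProduct.tmul_add, QuotientAddGroup.mk_add])
    (tensor_hom_ext _ fun r m => by
      simp [tensorLift_mk_tmul, ← mk_smul_tmul])
    (by ext; simp [tensorLift_mk_tmul])

theorem tensorLid_mk_tmul (r : R) (m : M) :
    tensorLid R M (QuotientAddGroup.mk (r ⊗ₜ[ℤ] m)) = r • m :=
  rfl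

theorem tensorLid_tensorMap (f : M →ₗ[R] N) (t : Tensor R R M) :
    tensorLid R N (tensorMap R f t) = f (tensorLid R M t) := by
  induction t using tensor_induction with
  | zero => simp
  | tmul p m => simp [tensorMap_mk_tmul, tensorLid_mk_tmul]
  | add x y hx hy => simp [hx, hy]

theorem exact_tensorMap_regular {A B C : Type u} [AddCommGroup A] [AddCommGroup B]
    [AddCommGroup C] [Module R A] [Module R B] [Module R C] {f : A →ₗ[R] B} {g : B →ₗ[R] C}
    (h : Function.Exact f g) : Function.Exact (tensorMap R f) (tensorMap R g) := by
  intro t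
  rw [← (tensorLid R C).map_eq_zero_iff, tensorLid_tensorMap, h]
  constructor
  · rintro ⟨a, ha⟩
    refine ⟨(tensorLid R A).symm a, (tensorLid R B).injective ?_⟩
    rw [tensorLid_tensorMap, AddEquiv.apply_symm_apply, ha]
  · rintro ⟨s, rfl⟩
    exact ⟨tensorLid R A s, (tensorLid_tensorMap _ _).symm⟩

/-- The `j`-th component of `p ⊗ m` is `p j • m`, so the second factors of a finite sum of tensors
span all components, uniformly in `j`. -/
theorem exists_finite_forall_mem_span {J : Type u} (s : Tensor R (J → R) M) :
    ∃ Y : Set M, Y.Finite ∧ ∀ j : J,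
      tensorLid R M (tensorMapLeft M (LinearMap.proj j) s) ∈ Submodule.span R Y := by
  induction s using tensor_induction with
  | zero => exact ⟨∅, Set.finite_empty, by simp⟩
  | tmul p m =>
    refine ⟨{m}, Set.finite_singleton m, fun j => ?_⟩
    rw [tensorMapLeft_mk_tmul, tensorLid_mk_tmul]
    exact Submodule.smul_mem _ _ (Submodule.mem_span_singleton_self m)
  | add x y hx hy =>
    obtain ⟨Y, hY, hx⟩ := hx
    obtain ⟨Z, hZ, hy⟩ := hy
    refine ⟨Y ∪ Z, hY.union hZ, fun j => ?_⟩
    rw [map_add, map_add]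
    exact add_mem (Submodule.span_mono Set.subset_union_left (hx j))
      (Submodule.span_mono Set.subset_union_right (hy j))

/-- If tensoring with all powers of `R` preserves exactness of `A → B → C` at `B`, where `B` and
`C` are finitely generated free, then the image of `A` in `B` is finitely generated. -/
theorem fg_range_of_exact_tensorMap_pi {A B C : Type u} [AddCommGroup A] [AddCommGroup B]
    [AddCommGroup C] [Module R A] [Module R B] [Module R C] [Module.Finite R B]
    [Module.Free R B] [Module.Finite R C] [Module.Free R C] {f : A →ₗ[R] B} {g : B →ₗ[R] C}
    (hfg : Function.Exact f g)
    (h : ∀ J : Type u, Function.Exact (tensorMap (J → R) f) (tensorMap (J → R) g)) :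
    (LinearMap.range f).FG := by
  -- The index set is the image itself, and the component of `t` at `l` corresponds to `l`.
  obtain ⟨t, ht⟩ := exists_tensor_pi (R := R) (fun _ : LinearMap.range f => R)
    fun l => (tensorLid R B).symm l
  obtain ⟨s, rfl⟩ := (h (LinearMap.range f) t).1 <|
    tensor_pi_ext (R := R) (fun _ : LinearMap.range f => R) fun l => by
      rw [← tensorMap_tensorMapLeft, ht, map_zero, ← (tensorLid R C).map_eq_zero_iff,
        tensorLid_tensorMap, AddEquiv.apply_symm_apply]
      exact (hfg _).2 l.2
  obtain ⟨Y, hY, hs⟩ := exists_finite_forall_mem_span s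
  refine Submodule.fg_def.2 ⟨f '' Y, hY.image f, le_antisymm ?_ fun l hl => ?_⟩
  · rw [Submodule.span_le]
    rintro _ ⟨y, -, rfl⟩
    exact ⟨y, rfl⟩
  · have := congrArg (tensorLid R B) (ht ⟨l, hl⟩)
    rw [← tensorMap_tensorMapLeft, tensorLid_tensorMap, AddEquiv.apply_symm_apply] at this
    rw [← Submodule.map_span]
    exact ⟨_, hs ⟨l, hl⟩, this⟩

end Regular

end TensorFiniteFree

/-! ### Maps from finitely generated modules to direct limits. -/

section DirectLimit

variable {J : Type u} [Preorder J] [IsDirectedOrder J] [DecidableEq J] {G : J → Type u}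
  [∀ j, AddCommGroup (G j)] [∀ j, Module R (G j)] {f : ∀ i j, i ≤ j → G i →ₗ[R] G j}
  {A B C : Type u} [AddCommGroup A] [Module R A] [Module.Finite R A]
  [AddCommGroup B] [Module R B] [Module.Finite R B] [Module.Free R B] [AddCommGroup C] [Module R C]

/-- Finitely many basis vectors have representatives at a common stage, and freeness turns these
into a linear map. -/
theorem exists_directLimit_lift [Nonempty J] (φ : B →ₗ[R] Module.DirectLimit G f) :
    ∃ (i : J) (ψ : B →ₗ[R] G i), Module.DirectLimit.of R J G f i ∘ₗ ψ = φ := by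
  let b := Module.Free.chooseBasis R B
  choose i x hx using fun k => Module.DirectLimit.exists_of (φ (b k))
  obtain ⟨m, hm⟩ := Finite.exists_le i
  refine ⟨m, b.constr ℕ fun k => f (i k) m (hm k) (x k), b.ext fun k => ?_⟩
  rw [LinearMap.comp_apply, b.constr_basis, Module.DirectLimit.of_f, hx]

theorem exists_directLimit_eq_zero [DirectedSystem G (fun i j h => f i j h)] {i : J}
    (φ : A →ₗ[R] G i) (hφ : Module.DirectLimit.of R J G f i ∘ₗ φ = 0) :
    ∃ (j : J) (hij : i ≤ j), f i j hij ∘ₗ φ = 0 := by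
  have : Nonempty J := ⟨i⟩
  obtain ⟨s, hs⟩ := Module.Finite.fg_top (R := R) (M := A)
  choose j hj hj' using fun a : s =>
    Module.DirectLimit.of.zero_exact (LinearMap.congr_fun hφ (a : A))
  obtain ⟨m, hm⟩ := Finite.exists_le j
  obtain ⟨k, hik, hmk⟩ := exists_ge_ge i m
  refine ⟨k, hik, LinearMap.ext_on hs fun a ha => ?_⟩
  have h := DirectedSystem.map_map (f := fun i j h => f i j h) (hj ⟨a, ha⟩) ((hm ⟨a, ha⟩).trans hmk)
    (φ a)
  rw [LinearMap.comp_apply, ← h]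
  simp only [hj' ⟨a, ha⟩, map_zero, LinearMap.zero_apply]

/-- Finiteness brings both `φ` and the relation `φ ∘ₗ d = 0` down to a single stage, where `h`
applies. -/
theorem exists_extension_to_directLimit [Nonempty J]
    [DirectedSystem G (fun i j h => f i j h)] (d : A →ₗ[R] B) (e : B →ₗ[R] C)
    (h : ∀ j (φ : B →ₗ[R] G j), φ ∘ₗ d = 0 → ∃ ψ : C →ₗ[R] G j, ψ ∘ₗ e = φ)
    (φ : B →ₗ[R] Module.DirectLimit G f) (hφ : φ ∘ₗ d = 0) :
    ∃ ψ : C →ₗ[R] Module.DirectLimit G f, ψ ∘ₗ e = φ := by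
  obtain ⟨i, φ, rfl⟩ := exists_directLimit_lift φ
  obtain ⟨j, hij, hj⟩ := exists_directLimit_eq_zero (f := f) (φ ∘ₗ d) hφ
  obtain ⟨ψ, hψ⟩ := h j (f i j hij ∘ₗ φ) hj
  refine ⟨Module.DirectLimit.of R J G f j ∘ₗ ψ, ?_⟩
  rw [LinearMap.comp_assoc, hψ]
  ext x
  exact Module.DirectLimit.of_f

end DirectLimit

/-! ### A direct system of injectives detecting finite generation. -/

section HullSystem

variable {B : Type u} [AddCommGroup B] [Module R B] (L : Submodule R B)

/-- The finitely generated submodules of `L`. -/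
abbrev FGSubmodule : Type u := {S : Submodule R B // S.FG ∧ S ≤ L}

instance : IsDirectedOrder (FGSubmodule L) where
  directed S T := ⟨⟨S.1 ⊔ T.1, S.2.1.sup T.2.1, sup_le S.2.2 T.2.2⟩,
    le_sup_left (a := S.1), le_sup_right (a := S.1)⟩

instance : Nonempty (FGSubmodule L) := ⟨⟨⊥, Submodule.fg_bot, bot_le⟩⟩

/-- An injective module containing `B ⧸ S`. -/
noncomputable abbrev quotientHull (S : FGSubmodule L) : ModuleCat.{u} R :=
  Injective.under (ModuleCat.of R (B ⧸ S.1))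

/-- The map from `B` to the injective hull of `B ⧸ S`. -/
noncomputable def toQuotientHull (S : FGSubmodule L) : B →ₗ[R] quotientHull L S :=
  (Injective.ι (ModuleCat.of R (B ⧸ S.1))).hom ∘ₗ S.1.mkQ

theorem toQuotientHull_eq_zero_iff (S : FGSubmodule L) (x : B) :
    toQuotientHull L S x = 0 ↔ x ∈ S.1 := by
  rw [toQuotientHull, LinearMap.comp_apply, map_eq_zero_iff _
    ((ModuleCat.mono_iff_injective (Injective.ι (ModuleCat.of R (B ⧸ S.1)))).1 inferInstance),
    Submodule.mkQ_apply, Submodule.Quotient.mk_eq_zero]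

/-- The product of the injective modules attached to the submodules containing `S`. -/
noncomputable abbrev hullProd (S : FGSubmodule L) : ModuleCat.{u} R :=
  ModuleCat.of R (∀ T : {T : FGSubmodule L // S ≤ T}, quotientHull L T.1)

/-- The projections between the modules `hullProd`. -/
noncomputable def hullProdMap (S S' : FGSubmodule L) (h : S ≤ S') : hullProd L S →ₗ[R] hullProd L S' :=
  LinearMap.pi fun T => LinearMap.proj (⟨T.1, h.trans T.2⟩ : {T : FGSubmodule L // S ≤ T})

/-- The reason for using products: projections compose strictly, whereas chosen extensions of `B ⧸ S
→ B ⧸ S'` to the injectives need not. -/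
instance : DirectedSystem (fun S => hullProd L S) (fun S S' h => hullProdMap L S S' h) where
  map_self _ _ := rfl
  map_map _ _ _ _ _ _ := rfl

/-- The map from `B` to `hullProd L S`. -/
noncomputable def toHullProd (S : FGSubmodule L) : B →ₗ[R] hullProd L S :=
  LinearMap.pi fun T => toQuotientHull L T.1

/-- The canonical map from `B` to the limit kills `L`, hence factors through `e`. At some stage `T`
the factorization already holds, so `B → B ⧸ T` kills `L` and `L ≤ T`. -/
theorem fg_of_exists_extension [Module.Finite R B] {A C : Type u} [AddCommGroup A] [Module R A]
    [AddCommGroup C] [Module R C] [Module.Finite R C] [Module.Free R C]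
    [DecidableEq (FGSubmodule L)] (d : A →ₗ[R] B) (e : B →ₗ[R] C) (hL : LinearMap.range d = L)
    (hed : e ∘ₗ d = 0)
    (h : ∀ φ : B →ₗ[R] Module.DirectLimit (fun S => hullProd L S) (hullProdMap L), φ ∘ₗ d = 0 →
      ∃ ψ : C →ₗ[R] Module.DirectLimit (fun S => hullProd L S) (hullProdMap L), ψ ∘ₗ e = φ) :
    L.FG := by
  let S₀ : FGSubmodule L := ⟨⊥, Submodule.fg_bot, bot_le⟩
  obtain ⟨ψ, hψ⟩ := h (Module.DirectLimit.of R _ _ _ S₀ ∘ₗ toHullProd L S₀) (by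
    ext a
    -- Every index of the product at this stage contains `d a`, so `d a` already dies here.
    let S : FGSubmodule L := ⟨R ∙ d a, Submodule.fg_span_singleton _,
      (Submodule.span_singleton_le_iff_mem _ _).2 (hL ▸ ⟨a, rfl⟩)⟩
    have h₀ : S₀ ≤ S := bot_le (a := S.1)
    have : hullProdMap L S₀ S h₀ (toHullProd L S₀ (d a)) = 0 := by
      ext T
      exact (toQuotientHull_eq_zero_iff L T.1 _).2 (T.2 (Submodule.mem_span_singleton_self _))
    simp only [LinearMap.comp_apply, LinearMap.zero_apply]
    rw [← Module.DirectLimit.of_f (hij := h₀), this, map_zero])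
  obtain ⟨S, ψ, rfl⟩ := exists_directLimit_lift ψ
  have h₀ : S₀ ≤ S := bot_le (a := S.1)
  have hof : Module.DirectLimit.of R _ (fun S => hullProd L S) (hullProdMap L) S₀ ∘ₗ
      toHullProd L S₀ = Module.DirectLimit.of R _ _ (hullProdMap L) S ∘ₗ toHullProd L S := by
    ext x
    exact (Module.DirectLimit.of_f (f := hullProdMap L) (hij := h₀)
      (x := toHullProd L S₀ x)).symm
  have hsub : Module.DirectLimit.of R _ (fun S => hullProd L S) (hullProdMap L) S ∘ₗ
      (ψ ∘ₗ e - toHullProd L S) = 0 := by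
    ext x
    have := LinearMap.congr_fun (hψ.trans hof) x
    simp only [LinearMap.comp_apply] at this
    simp only [LinearMap.comp_apply, LinearMap.sub_apply, map_sub, this, LinearMap.zero_apply]
    exact sub_self (G := Module.DirectLimit (fun S => hullProd L S) (hullProdMap L)) _
  obtain ⟨T, hST, hT⟩ := exists_directLimit_eq_zero _ hsub
  suffices L ≤ T.1 by
    rw [← T.2.2.antisymm this]
    exact T.2.1
  intro x hx
  obtain ⟨a, rfl⟩ : x ∈ LinearMap.range d := hL ▸ hx
  rw [← toQuotientHull_eq_zero_iff L T]
  -- The factor indexed by `T` itself tests membership in `T`.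
  have := congrFun (LinearMap.congr_fun hT (d a)) ⟨T, le_rfl⟩
  have hea : e (d a) = 0 := LinearMap.congr_fun hed a
  simp only [LinearMap.comp_apply, LinearMap.sub_apply, hea, map_zero, zero_sub, map_neg] at this
  exact neg_eq_zero.1 this

end HullSystem

/-! ### Products of injectives and the equivalences. -/

variable {X : ObjectProperty (ModuleCat.{u} R)} {m : ℕ}

/-- Extensions can be chosen factor by factor; this makes each `hullProd` admissible in the direct
limit condition. -/
theorem isInjective_pi {J : Type u} (I : J → ModuleCat.{u} R) [∀ j, Injective (I j)] :
    IsInjective X (m + 1) (ModuleCat.of R (∀ j, I j)) := by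
  intro N hN
  obtain ⟨Q, -⟩ := hN.2.exists_freeResolution
  rw [Q.subsingleton_ext_iff]
  intro φ hφ
  choose ψ hψ using fun j => (Q.subsingleton_ext_iff (I j) m).1
    (Abelian.Ext.subsingleton_of_injective N (I j) m) (LinearMap.proj j ∘ₗ φ) (by
      rw [LinearMap.comp_assoc, hφ, LinearMap.comp_zero])
  refine ⟨LinearMap.pi ψ, ?_⟩
  ext x j
  exact LinearMap.congr_fun (hψ j) x

end NXCoh

open NXCoh in
theorem mainTheorem1 {R : Type u} [Ring R] (n : ℕ) (hn : 1 ≤ n)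
    (X : ObjectProperty (ModuleCat.{u} R))
    (hX : ∃ M : ModuleCat.{u} R, NXCoh.nPresentedSubclass X n M) :
    List.TFAE [
      NXCoh.IsLeftCoherent X n,
      ∀ J : Type u, NXCoh.IsFlat X n (ModuleCat.of Rᵐᵒᵖ (J → R)),
      ∀ (J : Type u) (P : J → ModuleCat.{u} Rᵐᵒᵖ),
        (∀ j, NXCoh.IsFlat X n (P j)) →
          NXCoh.IsFlat X n (ModuleCat.of Rᵐᵒᵖ (∀ j, P j)),
      ∀ (J : Type u) [Preorder J] [IsDirectedOrder J] [Nonempty J] [DecidableEq J]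
        (N : J → ModuleCat.{u} R) (f : ∀ i j, i ≤ j → N i →ₗ[R] N j)
        [DirectedSystem (fun j => N j) (fun i j h => f i j h)],
        (∀ j, NXCoh.IsInjective X n (N j)) →
          NXCoh.IsInjective X n
            (ModuleCat.of R (Module.DirectLimit (fun j => N j) f))] := by
  obtain ⟨m, rfl⟩ : ∃ m, n = m + 1 := ⟨n - 1, by lia⟩
  tfae_have 1 → 3 := by
    intro h J P hP N hN
    -- Coherence provides finite generation one degree further, at `Q.F (m + 2)`.
    obtain ⟨Q, hQ⟩ := (h.2 N hN).exists_freeResolution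
    have := hQ (m + 1) (by lia)
    have := hQ (m + 2) (by lia)
    have := Q.free (m + 1)
    have := Q.free (m + 2)
    rw [Q.subsingleton_tor_iff]
    exact exact_tensorMap_pi (fun j => P j) (Q.exact_succ m).linearMap_comp_eq_zero
      fun j => (Q.subsingleton_tor_iff (P j) m).1 (hP j N hN)
  tfae_have 3 → 2 := by
    intro h J
    refine h J (fun _ => ModuleCat.of Rᵐᵒᵖ R) fun _ N hN => ?_
    obtain ⟨Q, -⟩ := hN.2.exists_freeResolution
    rw [Q.subsingleton_tor_iff]
    exact exact_tensorMap_regular (Q.exact_succ m)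
  tfae_have 2 → 1 := by
    refine fun h => ⟨hX, fun N hN => ?_⟩
    -- Here `Q.F (m + 2)` may be infinitely generated; the aim is that its image in `Q.F (m + 1)` is
    -- not.
    obtain ⟨Q, hQ⟩ := hN.2.exists_freeResolution
    have := hQ m (by lia)
    have := hQ (m + 1) (by lia)
    have := Q.free m
    have := Q.free (m + 1)
    exact Q.isNPresented_succ hQ (fg_range_of_exact_tensorMap_pi (Q.exact_succ m)
      fun J => (Q.subsingleton_tor_iff (ModuleCat.of Rᵐᵒᵖ (J → R)) m).1 (h J N hN))
  tfae_have 1 → 4 := by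
    intro h J _ _ _ _ G f _ hG N hN
    obtain ⟨Q, hQ⟩ := (h.2 N hN).exists_freeResolution
    have := hQ (m + 1) (by lia)
    have := hQ (m + 2) (by lia)
    have := Q.free (m + 1)
    rw [Q.subsingleton_ext_iff]
    exact exists_extension_to_directLimit _ _
      fun j => (Q.subsingleton_ext_iff (G j) m).1 (hG j N hN)
  tfae_have 4 → 1 := by
    classical
    refine fun h => ⟨hX, fun N hN => ?_⟩
    obtain ⟨Q, hQ⟩ := hN.2.exists_freeResolution
    have := hQ m (by lia)
    have := hQ (m + 1) (by lia)
    have := Q.free m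
    exact Q.isNPresented_succ hQ (fg_of_exists_extension _ _ _ rfl
      (Q.exact_succ m).linearMap_comp_eq_zero ((Q.subsingleton_ext_iff _ m).1
        (h _ _ (hullProdMap (LinearMap.range (Q.d (m + 1)))) (fun S => isInjective_pi _) N hN)))
  tfae_finish
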